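/- Call a function $f:\mathbb R\to\mathbb R$ (Bohr) almost periodic if it is continuous and for each $\varepsilon>0$ there is $L>0$ such that every interval of length $L$ contains a $\tau$ with $|f(t+\tau)-f(t)|<\varepsilon$ for all $t\in\mathbb R$. A centred real Gaussian process $X=(X(t))_{t\in\mathbb R}$ is stationary with reduced covariance $C$ if $X(\cdot+h)$ has the same law as $X$ for every $h\in\mathbb R$ and $\operatorname{Cov}(X(s),X(t))=C(s-t)$ for all $s,t\in\mathbb R$. For a random set $Z\subset\mathbb R$, let $\sigma(Z)$ be the $\sigma$-algebra generated by the numbers of points (in $\mathbb N\cup\{\infty\}$) of $Z$ in the bounded open intervals; $Z$ is called completely predictable if $\sigma(Z)=\bigcap_{t\in\mathbb R}\sigma(Z\cap(-\infty,t))$. **Proposition.** Let $(a_i)_{i\ge 0}$ be a summable sequence of non-negative numbers, $(\varphi_i)_{i\ge 0}$ a sequence of real numbers, and $$C(x)=\sum_i a_i^2\cos(\varphi_i x),\qquad x\in\mathbb R.$$ Then $C$ is almost periodic, and it is the reduced covariance of a centred stationary Gaussian process $X$ which is almost surely bounded, almost surely almost periodic, and whose zero set $Z_X=\{t\in\mathbb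 R: X(t)=0\}$ is a random set (that is, $\sigma(Z_X)$ consists of events) that is completely predictable. Moreover, the function $x\mapsto\sum_i a_i\cos(\varphi_i x)$ is also almost periodic, and it is the reduced covariance of a centred stationary Gaussian process. -/

import Mathlib

open MeasureTheory ProbabilityTheory Set

/-- A Bohr almost periodic function on the real line: `f` is continuous and, for each `ε > 0`, there
is a length `L > 0` such that every interval of length `L` contains an `ε`-almost period of `f`. -/
def IsBohrAlmostPeriodic (f : ℝ → ℝ) : Prop :=
  Continuous f ∧ ∀ ε : ℝ, 0 < ε → ∃ L : ℝ, 0 < L ∧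
    ∀ s : ℝ, ∃ τ ∈ Icc s (s + L), ∀ t : ℝ, |f (t + τ) - f t| < ε

/-- `X` is a (centred, real) stationary Gaussian process on `(Ω, P)`, indexed by the real line, with
reduced covariance function `C`. -/
structure IsStationaryGaussian {Ω : Type*} [MeasurableSpace Ω] (P : Measure Ω)
    (X : ℝ → Ω → ℝ) (C : ℝ → ℝ) : Prop where
  measurable : ∀ t : ℝ, Measurable (X t)
  gaussian : IsGaussianProcess X P
  centred : ∀ t : ℝ, ∫ ω, X t ω ∂P = 0
  stationary : ∀ h : ℝ,
    P.map (fun (ω : Ω) (t : ℝ) => X (t + h) ω) = P.map (fun (ω : Ω) (t : ℝ) => X t ω)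
  covariance_eq : ∀ s t : ℝ, covariance (X s) (X t) P = C (s - t)

/-- The zero set of a random function. -/
def zeroSet {Ω : Type*} (X : ℝ → Ω → ℝ) (ω : Ω) : Set ℝ := {t : ℝ | X t ω = 0}

/-- The sigma-algebra `σ(Z)` of a random subset `Z` of the real line: it is generated by the numbers
of points (possibly infinite) of `Z` in the bounded open intervals. If `Z` is locally finite, this
is the usual sigma-algebra generated by `Z` as a point process; for closed `Z` it is the one
generated by the events that `Z` hits a given open set. -/
@[reducible] noncomputable def sigmaOf {Ω : Type*} (Z : Ω → Set ℝ) : MeasurableSpace Ω :=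
  ⨆ (u : ℝ) (v : ℝ), MeasurableSpace.comap (fun ω : Ω => (Z ω ∩ Ioo u v).encard) ⊤

/-- `Z` is completely predictable: `σ(Z)` is the intersection over all real `t` of the
sigma-algebras `σ(Z ∩ (-∞, t))`. -/
def IsCompletelyPredictable {Ω : Type*} (Z : Ω → Set ℝ) : Prop :=
  sigmaOf Z = ⨅ t : ℝ, sigmaOf (fun ω : Ω => Z ω ∩ Iio t)

/-! The process is X(t) = ∑ aᵢ (ξᵢ cos φᵢt + ηᵢ sin φᵢt) with independent standard Gaussian ξᵢ, ηᵢ.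
Since cos x cos y + sin x sin y = cos (x - y), its covariance is C. Almost surely ∑ aᵢ(|ξᵢ| + |ηᵢ|)
< ∞, and then the path is an absolutely convergent cosine series: bounded, and almost periodic
because the phases (φᵢt)ᵢ trace a one-parameter subgroup of a compact torus, which returns near 1
with bounded gaps (`exists_forall_mem_Icc_map_mem`).

For the zero set, almost surely every zero is a sign crossing (`ae_zerosAreCrossings_cosSeries`).
With all other coordinates frozen, the path is affine in one Gaussian coordinate, with slope a
cosine or sine term that is nonzero near the given time. Hence at most one value of that coordinate
makes the local infimum zero, and the Gaussian law has no atoms. Crossings survive small uniform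
perturbations. The recurrence gives a deterministic sequence τₙ → -∞ with X(· + τₙ) → X uniformly,
so zeros in a window can be read off from its translates in the remote past
(`isCompletelyPredictable_zeroSet`).

Complete predictability is an exact equality of σ-algebras, not one modulo null sets, so the path is
replaced by the constant 1 off a good measurable event.

The covariance ∑ aᵢ cos φᵢx has amplitudes √aᵢ, which need only be square-summable; there the series
is summed in L², without control of paths. -/

/-! ### Recurrence in compact groups. -/

-- Finitely many translates of a small neighbourhood cover the orbit closure, so each orbit point is
-- close to one of finitely many fixed orbit points; dividing returns it near 1. Continuity of `g`
-- plays no role.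
open Filter Topology in
theorem exists_forall_mem_Icc_map_mem {G : Type*} [CommGroup G] [TopologicalSpace G]
    [IsTopologicalGroup G] [CompactSpace G] (g : Multiplicative ℝ →* G) {U : Set G} (hU : U ∈ 𝓝 (1 : G)) :
    ∃ L : ℝ, 0 < L ∧ ∀ s : ℝ, ∃ τ ∈ Icc s (s + L), g (.ofAdd τ) ∈ U := by
  obtain ⟨V, hV, hVo, h1, hVU⟩ : ∃ V ∈ 𝓝 (1 : G), IsOpen V ∧ (1 : G) ∈ V ∧ ∀ x ∈ V, ∀ y ∈ V, x / y ∈ U := by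
    obtain ⟨V, hV, h⟩ := exists_nhds_split_inv hU
    refine ⟨interior V, interior_mem_nhds.2 hV, isOpen_interior, mem_interior_iff_mem_nhds.2 hV,
      fun x hx y hy => h x (interior_subset hx) y (interior_subset hy)⟩
  have hcover : closure (range g) ⊆ ⋃ s : ℝ, (fun z => z / g (.ofAdd s)) ⁻¹' V := by
    intro z hz
    have : (fun w => z / w) ⁻¹' V ∈ 𝓝 z := by
      have hc : Continuous fun w : G => z / w := by fun_prop
      exact hc.continuousAt.preimage_mem_nhds (by simpa using hV)
    obtain ⟨_, hw, ⟨s, rfl⟩⟩ := mem_closure_iff_nhds.1 hz _ this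
    exact mem_iUnion.2 ⟨s.toAdd, by simpa using hw⟩
  obtain ⟨T, hT⟩ := isClosed_closure.isCompact.elim_finite_subcover _
    (fun s => hVo.preimage (by fun_prop)) hcover
  obtain ⟨M, hM⟩ : ∃ M : ℝ, ∀ s ∈ T, |s| ≤ M := by
    obtain ⟨M, hM⟩ := (T.image (fun s => |s|)).exists_le
    exact ⟨M, fun s hs => hM _ (Finset.mem_image_of_mem _ hs)⟩
  -- Starting from time s + |M| and subtracting some r with |r| ≤ |M| lands in [s, s + 2|M|]; the
  -- extra 1 only makes the length positive.
  refine ⟨2 * |M| + 1, by positivity, fun s => ?_⟩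
  obtain ⟨r, hr, hrV⟩ : ∃ r ∈ T, g (.ofAdd (s + |M|)) / g (.ofAdd r) ∈ V := by
    simpa using hT (subset_closure (mem_range_self (Multiplicative.ofAdd (s + |M|))))
  have hb := abs_le.1 ((hM r hr).trans (le_abs_self M))
  refine ⟨s + |M| - r, ⟨by linarith, by linarith⟩, ?_⟩
  rw [ofAdd_sub, map_div]
  simpa using hVU _ hrV _ h1

/-- The distance of the phase `x` from a full turn. -/
noncomputable def phaseDist (x : ℝ) : ℝ := ‖(Circle.exp x : ℂ) - 1‖

theorem phaseDist_nonneg (x : ℝ) : 0 ≤ phaseDist x := norm_nonneg _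

theorem phaseDist_le_two (x : ℝ) : phaseDist x ≤ 2 := by
  refine (norm_sub_le _ _).trans ?_
  simp only [Circle.norm_coe, norm_one]; norm_num

/-- The difference is the real part of exp(ix)(exp(ih) - 1), whence a bound uniform in `x`. -/
theorem abs_cos_add_sub_cos_le (x h : ℝ) : |Real.cos (x + h) - Real.cos x| ≤ phaseDist h := by
  have : Real.cos (x + h) - Real.cos x = (((Circle.exp x : ℂ)) * ((Circle.exp h : ℂ) - 1)).re := by
    rw [mul_sub, mul_one, Complex.sub_re, ← Circle.coe_mul, ← Circle.exp_add, Circle.coe_exp, Circle.coe_exp,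
      Complex.exp_ofReal_mul_I_re, Complex.exp_ofReal_mul_I_re]
  rw [this]
  refine (Complex.abs_re_le_norm _).trans ?_
  rw [norm_mul, Circle.norm_coe, one_mul, phaseDist]

-- The weighted distance to 1 is continuous on the torus by the Weierstrass test, so its sublevel
-- sets are neighbourhoods of 1 even with infinitely many frequencies.
open Filter Topology in
theorem exists_tsum_mul_phaseDist_lt {ι : Type*} {b : ι → ℝ} (hb : Summable b) (hb0 : ∀ i, 0 ≤ b i)
    (θ : ι → ℝ) {ε : ℝ} (hε : 0 < ε) :
    ∃ L : ℝ, 0 < L ∧ ∀ s : ℝ, ∃ τ ∈ Icc s (s + L), ∑' i, b i * phaseDist (θ i * τ) < ε := by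
  let g : Multiplicative ℝ →* (ι → Circle) :=
    { toFun := fun τ i => Circle.exp (θ i * τ.toAdd)
      map_one' := by ext; simp
      map_mul' := by intro x y; ext; simp [mul_add, Circle.exp_add] }
  have hF : Continuous fun z : ι → Circle => ∑' i, b i * ‖(z i : ℂ) - 1‖ := by
    refine continuous_tsum (u := fun i => b i * 2) (fun i => by fun_prop) (hb.mul_right 2) fun i z => ?_
    rw [Real.norm_of_nonneg (mul_nonneg (hb0 i) (norm_nonneg _))]
    refine mul_le_mul_of_nonneg_left ?_ (hb0 i)
    refine (norm_sub_le _ _).trans ?_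
    simp only [Circle.norm_coe, norm_one]; norm_num
  have hU : {z : ι → Circle | ∑' i, b i * ‖(z i : ℂ) - 1‖ < ε} ∈ 𝓝 1 := by
    refine (isOpen_lt hF continuous_const).mem_nhds ?_
    simpa using hε
  exact exists_forall_mem_Icc_map_mem g hU

/-! ### Absolutely convergent cosine series. -/

/-- The almost periodic series with amplitudes `b`, frequencies `θ` and phases `δ`. -/
noncomputable def cosSeries {ι : Type*} (b θ δ : ι → ℝ) (t : ℝ) : ℝ :=
  ∑' i, b i * Real.cos (θ i * t + δ i)

section cosSeries
variable {ι : Type*} {b : ι → ℝ}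

theorem norm_mul_cos_le (x y : ℝ) : ‖x * Real.cos y‖ ≤ |x| := by
  rw [norm_mul, Real.norm_eq_abs, Real.norm_eq_abs]
  exact mul_le_of_le_one_right (abs_nonneg _) (Real.abs_cos_le_one _)

theorem summable_cosSeries (hb : Summable fun i => |b i|) (θ δ : ι → ℝ) (t : ℝ) :
    Summable fun i => b i * Real.cos (θ i * t + δ i) :=
  Summable.of_norm_bounded hb fun _ => norm_mul_cos_le _ _

theorem continuous_cosSeries (hb : Summable fun i => |b i|) (θ δ : ι → ℝ) :
    Continuous (cosSeries b θ δ) :=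
  continuous_tsum (fun i => by fun_prop) hb fun _ _ => norm_mul_cos_le _ _

theorem abs_cosSeries_le (hb : Summable fun i => |b i|) (θ δ : ι → ℝ) (t : ℝ) :
    |cosSeries b θ δ t| ≤ ∑' i, |b i| := by
  rw [← Real.norm_eq_abs]
  exact tsum_of_norm_bounded (f := fun i => b i * Real.cos (θ i * t + δ i)) hb.hasSum
    fun _ => norm_mul_cos_le _ _

theorem summable_mul_phaseDist (hb : Summable fun i => |b i|) (x : ι → ℝ) :
    Summable fun i => |b i| * phaseDist (x i) := by
  refine Summable.of_nonneg_of_le (fun i => mul_nonneg (abs_nonneg _) (phaseDist_nonneg _))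
    (fun i => mul_le_mul_of_nonneg_left (phaseDist_le_two _) (abs_nonneg _)) (hb.mul_right 2)

theorem abs_cosSeries_add_sub_le (hb : Summable fun i => |b i|) (θ δ : ι → ℝ) (t τ : ℝ) :
    |cosSeries b θ δ (t + τ) - cosSeries b θ δ t| ≤ ∑' i, |b i| * phaseDist (θ i * τ) := by
  unfold cosSeries
  rw [← (summable_cosSeries hb θ δ _).tsum_sub (summable_cosSeries hb θ δ _)]
  rw [← Real.norm_eq_abs]
  refine tsum_of_norm_bounded (summable_mul_phaseDist hb _).hasSum fun i => ?_
  rw [← mul_sub, norm_mul, Real.norm_eq_abs, Real.norm_eq_abs]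
  refine mul_le_mul_of_nonneg_left ?_ (abs_nonneg _)
  have := abs_cos_add_sub_cos_le (θ i * t + δ i) (θ i * τ)
  rwa [show θ i * (t + τ) + δ i = θ i * t + δ i + θ i * τ by ring]

theorem isBohrAlmostPeriodic_cosSeries (hb : Summable fun i => |b i|) (θ δ : ι → ℝ) :
    IsBohrAlmostPeriodic (cosSeries b θ δ) := by
  refine ⟨continuous_cosSeries hb θ δ, fun ε hε => ?_⟩
  obtain ⟨L, hL, h⟩ := exists_tsum_mul_phaseDist_lt hb (fun _ => abs_nonneg _) θ hε
  refine ⟨L, hL, fun s => ?_⟩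
  obtain ⟨τ, hτ, hlt⟩ := h s
  exact ⟨τ, hτ, fun t => (abs_cosSeries_add_sub_le hb θ δ t τ).trans_lt hlt⟩

-- A single strictly positive summable weight controls every frequency at once. The sequence depends
-- on `θ` alone, so it serves all random amplitudes simultaneously.
open Filter Topology in
theorem exists_tendsto_atBot_phaseDist [Countable ι] (θ : ι → ℝ) :
    ∃ τ : ℕ → ℝ, Tendsto τ atTop atBot ∧ ∀ i, Tendsto (fun n => phaseDist (θ i * τ n)) atTop (𝓝 0) := by
  have := Encodable.ofCountable ι
  obtain ⟨w, hw0, c, hw, -⟩ := posSumOfEncodable zero_lt_one ι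
  have key (n : ℕ) : ∃ τ : ℝ, τ ≤ -n ∧ ∑' i, w i * phaseDist (θ i * τ) < 1 / ((n : ℝ) + 1) := by
    obtain ⟨L, -, h⟩ := exists_tsum_mul_phaseDist_lt hw.summable (fun i => (hw0 i).le) θ
      (Nat.one_div_pos_of_nat (α := ℝ) (n := n))
    -- The window [-n - L, -n] forces τ ≤ -n.
    obtain ⟨τ, hτ, hlt⟩ := h (-n - L)
    exact ⟨τ, by linarith [hτ.2], hlt⟩
  choose τ hτ hlt using key
  refine ⟨τ, tendsto_atBot_mono hτ (tendsto_neg_atTop_atBot.comp tendsto_natCast_atTop_atTop),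
    fun i => ?_⟩
  have hs (n : ℕ) : Summable fun i => w i * phaseDist (θ i * τ n) := by
    simpa only [abs_of_pos (hw0 _)] using
      summable_mul_phaseDist (b := w) (by simpa only [abs_of_pos (hw0 _)] using hw.summable) _
  refine squeeze_zero (g := fun n : ℕ => 1 / ((n : ℝ) + 1) / w i) (fun n => phaseDist_nonneg _)
    (fun n => ?_) (by simpa using tendsto_one_div_add_atTop_nhds_zero_nat.div_const (w i))
  rw [le_div_iff₀ (hw0 i), mul_comm]
  exact ((hs n).le_tsum i fun j _ => mul_nonneg (hw0 j).le (phaseDist_nonneg _)).trans (hlt n).le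

open Filter Topology in
theorem eventually_abs_cosSeries_add_sub_lt {θ : ι → ℝ} {τ : ℕ → ℝ}
    (hτ : ∀ i, Tendsto (fun n => phaseDist (θ i * τ n)) atTop (𝓝 0))
    (hb : Summable fun i => |b i|) (δ : ι → ℝ) {ε : ℝ} (hε : 0 < ε) :
    ∀ᶠ n in atTop, ∀ t, |cosSeries b θ δ (t + τ n) - cosSeries b θ δ t| < ε := by
  have : Tendsto (fun n => ∑' i, |b i| * phaseDist (θ i * τ n)) atTop (𝓝 (∑' i, |b i| * 0)) := by
    refine tendsto_tsum_of_dominated_convergence (hb.mul_right 2) (fun i => (hτ i).const_mul _)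
      (Eventually.of_forall fun n i => ?_)
    rw [Real.norm_of_nonneg (mul_nonneg (abs_nonneg _) (phaseDist_nonneg _))]
    exact mul_le_mul_of_nonneg_left (phaseDist_le_two _) (abs_nonneg _)
  simp only [mul_zero, tsum_zero] at this
  filter_upwards [this.eventually_lt_const hε] with n hn t
  exact (abs_cosSeries_add_sub_le hb θ δ t _).trans_lt hn

end cosSeries

/-! ### The σ-algebra of a random set. -/

section sigmaOf
variable {Ω : Type*} {Z : Ω → Set ℝ}

theorem measurableSet_sigmaOf_hit (Z : Ω → Set ℝ) (u v : ℝ) :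
    MeasurableSet[sigmaOf Z] {ω | (Z ω ∩ Ioo u v).Nonempty} := by
  have h : MeasurableSpace.comap (fun ω : Ω => (Z ω ∩ Ioo u v).encard) ⊤ ≤ sigmaOf Z :=
    le_iSup₂_of_le u v le_rfl
  refine h _ ⟨{0}ᶜ, trivial, ?_⟩
  ext ω
  simp [nonempty_iff_ne_empty]

theorem sigmaOf_const (S : Set ℝ) : sigmaOf (fun _ : Ω => S) = ⊥ := by
  simp [sigmaOf, MeasurableSpace.comap_const]

/-- A rational separates the largest of k + 1 points from the others. This expresses counts through
hitting events by countable operations. -/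
theorem succ_le_encard_inter_Ioo_iff (S : Set ℝ) (u v : ℝ) (k : ℕ) :
    ((k + 1 : ℕ) : ℕ∞) ≤ (S ∩ Ioo u v).encard ↔
      ∃ r : ℚ, (r : ℝ) ∈ Ioo u v ∧ (k : ℕ∞) ≤ (S ∩ Ioo u r).encard ∧ (S ∩ Ioo (r : ℝ) v).Nonempty := by
  constructor
  · intro h
    obtain ⟨T, hTS, hT⟩ := exists_subset_encard_eq h
    have hfin : T.Finite := finite_of_encard_eq_coe hT
    lift T to Finset ℝ using hfin
    rw [encard_coe_eq_coe_finsetCard, Nat.cast_inj] at hT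
    have hne : T.Nonempty := Finset.card_pos.1 (by omega)
    set z := T.max' hne
    have hz : z ∈ T := T.max'_mem hne
    have hzS := hTS hz
    -- Inserting `u` keeps the set nonempty when k = 0.
    set w := (insert u (T.erase z)).max' (Finset.insert_nonempty _ _)
    have huw : u ≤ w := Finset.le_max' _ _ (by simp)
    have hwz : w < z := by
      rw [Finset.max'_lt_iff]
      intro y hy
      rcases Finset.mem_insert.1 hy with rfl | hy
      · exact hzS.2.1
      · exact lt_of_le_of_ne (T.le_max' y (Finset.mem_of_mem_erase hy)) (Finset.ne_of_mem_erase hy)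
    obtain ⟨r, hwr, hrz⟩ := exists_rat_btwn hwz
    refine ⟨r, ⟨huw.trans_lt hwr, hrz.trans hzS.2.2⟩, ?_, z, hzS.1, hrz, hzS.2.2⟩
    have hc : (T.erase z).card = k := by rw [Finset.card_erase_of_mem hz]; omega
    rw [← hc, ← encard_coe_eq_coe_finsetCard]
    refine encard_le_encard fun y hy => ?_
    have hyT := hTS (Finset.mem_of_mem_erase hy)
    refine ⟨hyT.1, hyT.2.1, lt_of_le_of_lt (Finset.le_max' _ _ ?_) hwr⟩
    exact Finset.mem_insert_of_mem hy
  · rintro ⟨r, hr, hk, z, hzS, hz⟩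
    have hd : z ∉ S ∩ Ioo u (r : ℝ) := fun h => (h.2.2.trans hz.1).false
    rw [Nat.cast_add, Nat.cast_one]
    calc (k : ℕ∞) + 1 ≤ (S ∩ Ioo u r).encard + 1 := by gcongr
      _ = (insert z (S ∩ Ioo u r)).encard := (encard_insert_of_notMem hd).symm
      _ ≤ (S ∩ Ioo u v).encard := by
        refine encard_le_encard (insert_subset ⟨hzS, hr.1.trans hz.1, hz.2⟩ ?_)
        exact inter_subset_inter_right _ (Ioo_subset_Ioo_right hr.2.le)

theorem sigmaOf_le_of_hit {m : MeasurableSpace Ω}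
    (h : ∀ u v : ℝ, MeasurableSet[m] {ω | (Z ω ∩ Ioo u v).Nonempty}) : sigmaOf Z ≤ m := by
  have hle (k : ℕ) : ∀ u v : ℝ, MeasurableSet[m] {ω | (k : ℕ∞) ≤ (Z ω ∩ Ioo u v).encard} := by
    induction k with
    | zero => simp
    | succ k ih =>
      intro u v
      simp_rw [succ_le_encard_inter_Ioo_iff]
      have : {ω | ∃ r : ℚ, (r : ℝ) ∈ Ioo u v ∧ (k : ℕ∞) ≤ (Z ω ∩ Ioo u r).encard ∧
          (Z ω ∩ Ioo (r : ℝ) v).Nonempty} = ⋃ r : ℚ, ⋃ _ : (r : ℝ) ∈ Ioo u v,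
          {ω | (k : ℕ∞) ≤ (Z ω ∩ Ioo u r).encard} ∩ {ω | (Z ω ∩ Ioo (r : ℝ) v).Nonempty} := by
        ext; simp; grind
      rw [this]
      exact MeasurableSet.iUnion fun r => MeasurableSet.iUnion fun _ => (ih _ _).inter (h _ _)
  refine iSup₂_le fun u v => ?_
  rw [← measurable_iff_comap_le]
  refine measurable_to_countable' fun n => ?_
  induction n using ENat.recTopCoe with
  | top =>
    have : (fun ω => (Z ω ∩ Ioo u v).encard) ⁻¹' {⊤} =
        ⋂ k : ℕ, {ω | (k : ℕ∞) ≤ (Z ω ∩ Ioo u v).encard} := by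
      ext ω
      simp only [mem_preimage, mem_singleton_iff, mem_iInter, mem_ofPred_eq]
      exact ⟨fun hω k => hω ▸ le_top, fun hω => ENat.eq_top_iff_forall_ge.2 hω⟩
    rw [this]
    exact MeasurableSet.iInter fun k => hle k u v
  | coe n =>
    have : (fun ω => (Z ω ∩ Ioo u v).encard) ⁻¹' {(n : ℕ∞)} =
        {ω | (n : ℕ∞) ≤ (Z ω ∩ Ioo u v).encard} \ {ω | ((n + 1 : ℕ) : ℕ∞) ≤ (Z ω ∩ Ioo u v).encard} := by
      ext ω
      simp only [mem_preimage, mem_singleton_iff, mem_sdiff, mem_ofPred_eq]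
      generalize (Z ω ∩ Ioo u v).encard = c
      induction c using ENat.recTopCoe with
      | top => simp
      | coe c => norm_cast; omega
    rw [this]
    exact (hle n u v).diff (hle (n + 1) u v)

theorem sigmaOf_inter_Iio_le (Z : Ω → Set ℝ) (t : ℝ) :
    sigmaOf (fun ω => Z ω ∩ Iio t) ≤ sigmaOf Z := by
  refine sigmaOf_le_of_hit fun u v => ?_
  have : ∀ ω, Z ω ∩ Iio t ∩ Ioo u v = Z ω ∩ Ioo u (min v t) := by
    intro ω; ext x; simp; tauto
  simp_rw [this]
  exact measurableSet_sigmaOf_hit _ _ _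

theorem isCompletelyPredictable_of_le (h : ∀ t, sigmaOf Z ≤ sigmaOf (fun ω => Z ω ∩ Iio t)) :
    IsCompletelyPredictable Z :=
  le_antisymm (le_iInf h) (iInf_le_of_le 0 (sigmaOf_inter_Iio_le Z 0))

theorem isCompletelyPredictable_const (S : Set ℝ) : IsCompletelyPredictable (fun _ : Ω => S) :=
  isCompletelyPredictable_of_le fun _ => by rw [sigmaOf_const]; exact bot_le

end sigmaOf

/-! ### Zero sets of processes whose zeros are crossings. -/

/-- Every zero of `f` is an accumulation point of both positive and negative values of `f`. -/
def ZerosAreCrossings (f : ℝ → ℝ) : Prop :=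
  ∀ z u v : ℝ, f z = 0 → z ∈ Ioo u v → (∃ p ∈ Ioo u v, f p < 0) ∧ ∃ q ∈ Ioo u v, 0 < f q

theorem Continuous.exists_zero_mem_Ioo {f : ℝ → ℝ} (hf : Continuous f) {u v p q : ℝ} (hp : p ∈ Ioo u v)
    (hq : q ∈ Ioo u v) (hfp : f p < 0) (hfq : 0 < f q) : ∃ z ∈ Ioo u v, f z = 0 :=
  isPreconnected_Ioo.intermediate_value hp hq hf.continuousOn ⟨hfp.le, hfq.le⟩

section zeroSet
variable {Ω : Type*} {X : ℝ → Ω → ℝ}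

/-- For continuous paths with crossing zeros, an interval is hit exactly when both signs occur at
rational times in it. -/
theorem sigmaOf_zeroSet_le {m : MeasurableSpace Ω} (hm : ∀ t, Measurable (X t))
    (hc : ∀ ω, Continuous fun t => X t ω) (hX : ∀ ω, ZerosAreCrossings fun t => X t ω) :
    sigmaOf (zeroSet X) ≤ m := by
  refine sigmaOf_le_of_hit fun u v => ?_
  have : {ω | (zeroSet X ω ∩ Ioo u v).Nonempty} =
      (⋃ p : ℚ, ⋃ _ : (p : ℝ) ∈ Ioo u v, {ω | X p ω < 0}) ∩
        ⋃ q : ℚ, ⋃ _ : (q : ℝ) ∈ Ioo u v, {ω | 0 < X q ω} := by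
    ext ω
    simp only [mem_inter_iff, mem_iUnion, mem_ofPred_eq, exists_prop]
    constructor
    · rintro ⟨z, hz, hzuv⟩
      obtain ⟨⟨p, hp, hXp⟩, q, hq, hXq⟩ := hX ω z u v hz hzuv
      constructor
      · obtain ⟨r, hr⟩ := Rat.denseRange_cast.exists_mem_open
          ((isOpen_lt (hc ω) continuous_const).inter isOpen_Ioo) ⟨p, hXp, hp⟩
        exact ⟨r, hr.2, hr.1⟩
      · obtain ⟨r, hr⟩ := Rat.denseRange_cast.exists_mem_open
          ((isOpen_lt continuous_const (hc ω)).inter isOpen_Ioo) ⟨q, hXq, hq⟩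
        exact ⟨r, hr.2, hr.1⟩
    · rintro ⟨⟨p, hp, hXp⟩, q, hq, hXq⟩
      obtain ⟨z, hz, h0⟩ := (hc ω).exists_zero_mem_Ioo hp hq hXp hXq
      exact ⟨z, h0, hz⟩
  rw [this]
  exact (MeasurableSet.iUnion fun p => MeasurableSet.iUnion fun _ =>
    measurableSet_lt (hm _) measurable_const).inter
    (MeasurableSet.iUnion fun q => MeasurableSet.iUnion fun _ =>
    measurableSet_lt measurable_const (hm _))

-- An interval is hit iff, for some rationals p, q with u < p and q < v, the translates (p + τₙ, q +
-- τₙ) contain zeros before `t` for infinitely many n. Crossings give one direction, compactness of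
-- [p, q] the other.
open Filter Topology in
theorem isCompletelyPredictable_zeroSet (hc : ∀ ω, Continuous fun t => X t ω)
    (hX : ∀ ω, ZerosAreCrossings fun t => X t ω) {τ : ℕ → ℝ} (hτ : Tendsto τ atTop atBot)
    (hlim : ∀ ω, ∀ ε > 0, ∀ᶠ n in atTop, ∀ t, |X (t + τ n) ω - X t ω| < ε) :
    IsCompletelyPredictable (zeroSet X) := by
  refine isCompletelyPredictable_of_le fun t => sigmaOf_le_of_hit fun u v => ?_
  have : {ω | (zeroSet X ω ∩ Ioo u v).Nonempty} =
      ⋃ p : ℚ, ⋃ _ : u < p, ⋃ q : ℚ, ⋃ _ : (q : ℝ) < v, ⋂ N : ℕ, ⋃ n : ℕ, ⋃ _ : N ≤ n,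
        {ω | (zeroSet X ω ∩ Iio t ∩ Ioo (p + τ n) (q + τ n)).Nonempty} := by
    ext ω
    simp only [mem_iInter, mem_iUnion, mem_ofPred_eq, exists_prop]
    constructor
    · rintro ⟨z, hz, huz, hzv⟩
      obtain ⟨p, hup, hpz⟩ := exists_rat_btwn huz
      obtain ⟨q, hzq, hqv⟩ := exists_rat_btwn hzv
      refine ⟨p, hup, q, hqv, ?_⟩
      obtain ⟨⟨p', hp', hXp⟩, q', hq', hXq⟩ := hX ω z p q hz ⟨hpz, hzq⟩
      intro N
      have h3 : ∀ᶠ n in atTop, q + τ n < t :=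
        (hτ.eventually_lt_atBot (t - q)).mono fun n hn => by linarith
      obtain ⟨n, h1, h2, h3, h4⟩ := ((hlim ω _ (neg_pos.2 hXp)).and ((hlim ω _ hXq).and
        (h3.and (eventually_ge_atTop N)))).exists
      refine ⟨n, h4, ?_⟩
      obtain ⟨w, hw, h0⟩ := (hc ω).exists_zero_mem_Ioo (u := p + τ n) (v := q + τ n)
        (p := p' + τ n) (q := q' + τ n)
        ⟨by linarith [hp'.1], by linarith [hp'.2]⟩ ⟨by linarith [hq'.1], by linarith [hq'.2]⟩
        (by linarith [(abs_lt.1 (h1 p')).2]) (by linarith [(abs_lt.1 (h2 q')).1])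
      exact ⟨w, ⟨h0, hw.2.trans h3⟩, hw⟩
    · rintro ⟨p, hup, q, hqv, h⟩
      by_contra hne
      have hnz : ∀ z ∈ Icc (p : ℝ) q, X z ω ≠ 0 := fun z hz h0 =>
        hne ⟨z, h0, hup.trans_le hz.1, hz.2.trans_lt hqv⟩
      -- One occurrence is used only to see that p ≤ q.
      obtain ⟨_, _, w, _, hw⟩ := h 0
      have hpq : (p : ℝ) ≤ q := by linarith [hw.1, hw.2]
      obtain ⟨x, hx, hmin⟩ := isCompact_Icc.exists_isMinOn (nonempty_Icc.2 hpq)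
        (hc ω).abs.continuousOn
      -- Once the translate is closer to the path than the positive minimum of |X| on [p, q], it has
      -- no zero in the translated window.
      obtain ⟨N, hN⟩ := eventually_atTop.1 (hlim ω _ (abs_pos.2 (hnz x hx)))
      obtain ⟨n, hn, z, ⟨hz0, -⟩, hz⟩ := h N
      have h1 := hN n hn (z - τ n)
      have hz0 : X z ω = 0 := hz0
      rw [sub_add_cancel, hz0, zero_sub, abs_neg] at h1
      exact h1.not_ge (hmin ⟨by linarith [hz.1], by linarith [hz.2]⟩)
  rw [this]
  refine MeasurableSet.iUnion fun p => MeasurableSet.iUnion fun _ => MeasurableSet.iUnion fun q =>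
    MeasurableSet.iUnion fun _ => MeasurableSet.iInter fun N => MeasurableSet.iUnion fun n =>
    MeasurableSet.iUnion fun _ => ?_
  exact measurableSet_sigmaOf_hit _ _ _

end zeroSet

/-! ### Resampling one coordinate of a product measure. -/

section resample
variable {ι : Type*} [DecidableEq ι]

theorem measurable_update_prod {E : ι → Type*} [∀ i, MeasurableSpace (E i)] (k : ι) :
    Measurable fun z : (∀ i, E i) × E k => Function.update z.1 k z.2 := by
  refine measurable_pi_iff.2 fun i => ?_
  by_cases h : i = k
  · subst h; simpa using measurable_snd
  · have : (fun z : (∀ i, E i) × E k => Function.update z.1 k z.2 i) = fun z => z.1 i := by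
      ext z; exact Function.update_of_ne h _ _
    rw [this]
    exact (measurable_pi_apply i).comp measurable_fst

/-- Resampling one coordinate independently leaves a product probability measure invariant. -/
theorem map_update_prod_infinitePi {E : ι → Type*} [∀ i, MeasurableSpace (E i)]
    (μ : ∀ i, Measure (E i)) [∀ i, IsProbabilityMeasure (μ i)] (k : ι) :
    ((Measure.infinitePi μ).prod (μ k)).map (fun z => Function.update z.1 k z.2) =
      Measure.infinitePi μ := by
  have hmeas := measurable_update_prod (E := E) k
  refine Measure.eq_infinitePi μ fun s t ht => ?_
  rw [Measure.map_apply hmeas (MeasurableSet.pi s.countable_toSet fun i _ => ht i)]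
  have h : (fun z : (∀ i, E i) × E k => Function.update z.1 k z.2) ⁻¹' Set.pi s t =
      Set.pi (s.erase k) t ×ˢ (if k ∈ s then t k else univ) := by
    ext ⟨ω, x⟩
    simp only [mem_preimage, mem_pi, Finset.mem_coe, mem_prod, Finset.mem_erase]
    constructor
    · refine fun h => ⟨fun i hi => by simpa [Function.update_of_ne hi.1] using h i hi.2, ?_⟩
      split_ifs with hk
      · simpa using h k hk
      · trivial
    · rintro ⟨h1, h2⟩ i hi
      by_cases hik : i = k
      · subst hik; simpa [hi] using h2
      · simpa [Function.update_of_ne hik] using h1 i ⟨hik, hi⟩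
  rw [h, Measure.prod_prod, Measure.infinitePi_pi _ fun i _ => ht i]
  split_ifs with hk
  · exact Finset.prod_erase_mul _ _ hk
  · rw [measure_univ, mul_one, Finset.erase_eq_of_notMem hk]

/-- A measurable set which every line in the direction of one atomless coordinate meets at most once
is negligible. -/
theorem infinitePi_eq_zero_of_subsingleton {μ : ι → Measure ℝ}
    [∀ i, IsProbabilityMeasure (μ i)] (k : ι) [NullSingletonClass (μ k)] {B : Set (ι → ℝ)} (hB : MeasurableSet B)
    (h : ∀ ω : ι → ℝ, {x : ℝ | Function.update ω k x ∈ B}.Subsingleton) :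
    Measure.infinitePi μ B = 0 := by
  have hmeas := measurable_update_prod (E := fun _ : ι => ℝ) k
  rw [← map_update_prod_infinitePi μ k, Measure.map_apply hmeas hB,
    Measure.measure_prod_null (hmeas hB)]
  exact Filter.Eventually.of_forall fun ω => (h ω).measure_zero _

end resample

/-! ### Almost surely, zeros of the random series are crossings. -/

section randomSeries
variable {ι : Type*}

/-- The configurations of amplitudes for which the random series converges absolutely. -/
def absSummableSet (b : ι → ℝ) : Set (ι → ℝ) := {ω | Summable fun i => |b i * ω i|}

theorem mem_absSummableSet_iff {b ω : ι → ℝ} :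
    ω ∈ absSummableSet b ↔ ∑' i, ENNReal.ofReal |b i * ω i| ≠ ⊤ := by
  simp only [absSummableSet, mem_ofPred_eq]
  refine ⟨fun h => h.tsum_ofReal_ne_top, fun h => ?_⟩
  have := ENNReal.summable_toReal h
  simpa using this

theorem measurable_tsum_ofReal_abs_mul [Countable ι] (b : ι → ℝ) :
    Measurable fun ω : ι → ℝ => ∑' i, ENNReal.ofReal |b i * ω i| :=
  Measurable.tsum fun i => by fun_prop

theorem measurableSet_absSummableSet [Countable ι] (b : ι → ℝ) : MeasurableSet (absSummableSet b) := by
  have : absSummableSet b = {ω | ∑' i, ENNReal.ofReal |b i * ω i| ≠ ⊤} :=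
    ext fun _ => mem_absSummableSet_iff
  rw [this]
  exact (measurableSet_singleton _).compl.preimage (measurable_tsum_ofReal_abs_mul b)

/-- The series is affine in each coordinate, with the coefficient function as slope. -/
theorem cosSeries_update [DecidableEq ι] {b ω : ι → ℝ} (hω : ω ∈ absSummableSet b) (θ δ : ι → ℝ)
    (k : ι) (x t : ℝ) :
    cosSeries (fun i => b i * Function.update ω k x i) θ δ t =
      cosSeries (fun i => b i * ω i) θ δ t + b k * Real.cos (θ k * t + δ k) * (x - ω k) := by
  have h := (summable_cosSeries hω θ δ t).hasSum.update k (b k * x * Real.cos (θ k * t + δ k))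
  have : (fun i => b i * Function.update ω k x i * Real.cos (θ i * t + δ i)) =
      Function.update (fun i => b i * ω i * Real.cos (θ i * t + δ i)) k
        (b k * x * Real.cos (θ k * t + δ k)) := by
    ext i
    by_cases h : i = k
    · subst h; simp
    · simp [Function.update_of_ne h]
  unfold cosSeries
  rw [this, h.tsum_eq]
  ring

/-- The event that the random series has infimum zero over the set of times `T`. -/
def touchingSet (b θ δ : ι → ℝ) (T : Set ℝ) : Set (ι → ℝ) :=
  {ω | ω ∈ absSummableSet b ∧ (∀ t ∈ T, 0 ≤ cosSeries (fun i => b i * ω i) θ δ t) ∧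
    ∀ n : ℕ, ∃ t ∈ T, cosSeries (fun i => b i * ω i) θ δ t < 1 / ((n : ℝ) + 1)}

theorem measurableSet_touchingSet [Countable ι] (b θ δ : ι → ℝ) {T : Set ℝ} (hT : T.Countable) :
    MeasurableSet (touchingSet b θ δ T) := by
  have hm (t : ℝ) : Measurable fun ω : ι → ℝ => cosSeries (fun i => b i * ω i) θ δ t :=
    Measurable.tsum fun i => by fun_prop
  have : touchingSet b θ δ T = absSummableSet b ∩
      ((⋂ t ∈ T, {ω | 0 ≤ cosSeries (fun i => b i * ω i) θ δ t}) ∩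
        ⋂ n : ℕ, ⋃ t ∈ T, {ω | cosSeries (fun i => b i * ω i) θ δ t < 1 / ((n : ℝ) + 1)}) := by
    ext; simp [touchingSet]; tauto
  rw [this]
  refine (measurableSet_absSummableSet b).inter (MeasurableSet.inter ?_ ?_)
  · exact MeasurableSet.biInter hT fun t _ => measurableSet_le measurable_const (hm t)
  · exact MeasurableSet.iInter fun n =>
      MeasurableSet.biUnion hT fun t _ => measurableSet_lt (hm t) measurable_const

/-- Almost surely, the random series does not have infimum zero over a countable set of times on which
one of its coefficient functions is bounded away from zero. -/
theorem infinitePi_touchingSet_eq_zero [Countable ι] {μ : ι → Measure ℝ} [∀ i, IsProbabilityMeasure (μ i)]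
    [∀ i, NullSingletonClass (μ i)] (b θ δ : ι → ℝ) (k : ι) {T : Set ℝ} (hT : T.Countable) {η : ℝ} (hη : 0 < η)
    (h : (∀ t ∈ T, η ≤ b k * Real.cos (θ k * t + δ k)) ∨ ∀ t ∈ T, b k * Real.cos (θ k * t + δ k) ≤ -η) :
    Measure.infinitePi μ (touchingSet b θ δ T) = 0 := by
  classical
  refine infinitePi_eq_zero_of_subsingleton k (measurableSet_touchingSet b θ δ hT)
    fun ω x hx y hy => ?_
  have key : ∀ x y : ℝ, x < y →
      Function.update ω k x ∈ touchingSet b θ δ T →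
      Function.update ω k y ∈ touchingSet b θ δ T → False := by
    rintro x y hxy ⟨hx0, hx1, hx2⟩ ⟨-, hy1, hy2⟩
    have hd (t : ℝ) : cosSeries (fun i => b i * Function.update ω k y i) θ δ t =
        cosSeries (fun i => b i * Function.update ω k x i) θ δ t +
          b k * Real.cos (θ k * t + δ k) * (y - x) := by
      have := cosSeries_update hx0 θ δ k y t
      simpa using this
    have hpos : 0 < η * (y - x) := mul_pos hη (sub_pos.2 hxy)
    obtain ⟨n, hn⟩ := exists_nat_one_div_lt hpos
    -- Raising the coordinate from x to y moves the series on T up (or down) by at least η(y - x),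
    -- so the infimum cannot vanish at both values.
    rcases h with h | h
    · obtain ⟨t, ht, hlt⟩ := hy2 n
      rw [hd] at hlt
      have := mul_le_mul_of_nonneg_right (h t ht) (sub_pos.2 hxy).le
      linarith [hx1 t ht]
    · obtain ⟨t, ht, hlt⟩ := hx2 n
      have h0 := hy1 t ht
      rw [hd] at h0
      have := mul_le_mul_of_nonneg_right (h t ht) (sub_pos.2 hxy).le
      linarith
  rcases lt_trichotomy x y with hxy | hxy | hxy
  · exact (key x y hxy hx hy).elim
  · exact hxy
  · exact (key y x hxy hy hx).elim

theorem cosSeries_neg (b θ δ : ι → ℝ) (t : ℝ) :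
    cosSeries (fun i => -b i) θ δ t = -cosSeries b θ δ t := by
  simp [cosSeries, tsum_neg]

/-- If at each time some coefficient function of the random series does not vanish, then almost surely
all zeros of the series are crossings. -/
theorem ae_zerosAreCrossings_cosSeries [Countable ι] {μ : ι → Measure ℝ} [∀ i, IsProbabilityMeasure (μ i)]
    [∀ i, NullSingletonClass (μ i)] (b θ δ : ι → ℝ)
    (h : ∀ t, ∃ k, b k * Real.cos (θ k * t + δ k) ≠ 0) :
    ∀ᵐ ω ∂Measure.infinitePi μ, ω ∈ absSummableSet b →
      ZerosAreCrossings (cosSeries (fun i => b i * ω i) θ δ) := by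
  -- Rational endpoints and thresholds 1/(m + 1) leave only countably many null events.
  have hnull (b : ι → ℝ) : ∀ᵐ ω ∂Measure.infinitePi μ, ∀ (k : ι) (p q : ℚ) (m : ℕ),
      ((∀ t ∈ Ioo (p : ℝ) q ∩ range ((↑) : ℚ → ℝ), 1 / ((m : ℝ) + 1) ≤ b k * Real.cos (θ k * t + δ k)) ∨
        ∀ t ∈ Ioo (p : ℝ) q ∩ range ((↑) : ℚ → ℝ), b k * Real.cos (θ k * t + δ k) ≤ -(1 / ((m : ℝ) + 1))) →
      ω ∉ touchingSet b θ δ (Ioo (p : ℝ) q ∩ range ((↑) : ℚ → ℝ)) := by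
    simp_rw [ae_all_iff]
    intro k p q m hk
    rw [ae_iff]
    simp only [not_not]
    exact infinitePi_touchingSet_eq_zero b θ δ k ((countable_range _).mono inter_subset_right)
      Nat.one_div_pos_of_nat hk
  have hneg {b ω : ι → ℝ} (z u v : ℝ) (hω : ω ∈ absSummableSet b)
      (h : ∃ k, b k * Real.cos (θ k * z + δ k) ≠ 0)
      (hz : cosSeries (fun i => b i * ω i) θ δ z = 0) (hzuv : z ∈ Ioo u v)
      (hn : ∀ (k : ι) (p q : ℚ) (m : ℕ),
      ((∀ t ∈ Ioo (p : ℝ) q ∩ range ((↑) : ℚ → ℝ), 1 / ((m : ℝ) + 1) ≤ b k * Real.cos (θ k * t + δ k)) ∨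
        ∀ t ∈ Ioo (p : ℝ) q ∩ range ((↑) : ℚ → ℝ), b k * Real.cos (θ k * t + δ k) ≤ -(1 / ((m : ℝ) + 1))) →
      ω ∉ touchingSet b θ δ (Ioo (p : ℝ) q ∩ range ((↑) : ℚ → ℝ))) :
      ∃ t ∈ Ioo u v, cosSeries (fun i => b i * ω i) θ δ t < 0 := by
    obtain ⟨k, hk⟩ := h
    -- Without negative values near z, the series has infimum zero on a rational interval around z
    -- where the k-th coefficient keeps away from zero.
    by_contra! hcon
    have hcS := continuous_cosSeries hω θ δ
    have hcc : Continuous fun t => b k * Real.cos (θ k * t + δ k) := by fun_prop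
    obtain ⟨m, hm⟩ := exists_nat_one_div_lt (abs_pos.2 hk)
    have hnear : ∀ᶠ t in nhds z, t ∈ Ioo u v ∧
        ((0 < b k * Real.cos (θ k * z + δ k) → 1 / ((m : ℝ) + 1) < b k * Real.cos (θ k * t + δ k)) ∧
        (b k * Real.cos (θ k * z + δ k) < 0 → b k * Real.cos (θ k * t + δ k) < -(1 / ((m : ℝ) + 1)))) := by
      refine Filter.Eventually.and (isOpen_Ioo.mem_nhds hzuv) (Filter.Eventually.and ?_ ?_)
      · by_cases hp : 0 < b k * Real.cos (θ k * z + δ k)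
        · rw [abs_of_pos hp] at hm
          filter_upwards [hcc.continuousAt.eventually_const_lt hm] with t ht _ using ht
        · exact Filter.Eventually.of_forall fun t h => (hp h).elim
      · by_cases hp : b k * Real.cos (θ k * z + δ k) < 0
        · rw [abs_of_neg hp, lt_neg] at hm
          filter_upwards [hcc.continuousAt.eventually_lt_const hm] with t ht _ using ht
        · exact Filter.Eventually.of_forall fun t h => (hp h).elim
    obtain ⟨u', v', hz', hsub⟩ := mem_nhds_iff_exists_Ioo_subset.1 hnear
    obtain ⟨p, hup, hpz⟩ := exists_rat_btwn hz'.1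
    obtain ⟨q, hzq, hqv⟩ := exists_rat_btwn hz'.2
    have hpq : ∀ t ∈ Ioo (p : ℝ) q, t ∈ Ioo u' v' := fun t ht => ⟨hup.trans ht.1, ht.2.trans hqv⟩
    refine hn k p q m ?_ ⟨hω, fun t ht => hcon t (hsub (hpq t ht.1)).1, fun n => ?_⟩
    · rcases hk.lt_or_gt with h | h
      · exact Or.inr fun t ht => ((hsub (hpq t ht.1)).2.2 h).le
      · exact Or.inl fun t ht => ((hsub (hpq t ht.1)).2.1 h).le
    · have hlt : cosSeries (fun i => b i * ω i) θ δ z < 1 / ((n : ℝ) + 1) := by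
        rw [hz]; exact Nat.one_div_pos_of_nat
      obtain ⟨r, hr⟩ := Rat.denseRange_cast.exists_mem_open
        ((isOpen_lt hcS continuous_const).inter isOpen_Ioo) ⟨z, hlt, hpz, hzq⟩
      exact ⟨r, ⟨hr.2, r, rfl⟩, hr.1⟩
  -- Positive values come from the same argument for the negated series.
  filter_upwards [hnull b, hnull fun i => -b i] with ω h1 h2 hω z u v hz hzuv
  refine ⟨hneg z u v hω (h z) hz hzuv h1, ?_⟩
  have hω' : ω ∈ absSummableSet fun i => -b i := by simpa [absSummableSet] using hω
  obtain ⟨t, ht, hlt⟩ := hneg z u v hω' (by simpa using h z)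
    (by simpa only [neg_mul, cosSeries_neg, neg_eq_zero] using hz) hzuv h2
  exact ⟨t, ht, by simpa only [neg_mul, cosSeries_neg, neg_lt_zero] using hlt⟩

end randomSeries

theorem ContinuousLinearMap.apply_eq_sum_single {ι : Type*} [Fintype ι] [DecidableEq ι]
    (L : StrongDual ℝ (ι → ℝ)) (x : ι → ℝ) : L x = ∑ i, L (Pi.single i 1) * x i := by
  conv_lhs => rw [← Finset.univ_sum_single x, map_sum]
  refine Finset.sum_congr rfl fun i _ => ?_
  have : (Pi.single i (x i) : ι → ℝ) = x i • Pi.single i 1 := by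
    rw [← Pi.single_smul]; simp
  rw [this, map_smul, smul_eq_mul, mul_comm]

/-! ### Stationarity from the covariance. -/

section stationary
variable {Ω : Type*} {mΩ : MeasurableSpace Ω} {P : Measure Ω} {X : ℝ → Ω → ℝ}

/-- A centred Gaussian process whose covariance depends only on the time difference is stationary. -/
theorem ProbabilityTheory.IsGaussianProcess.map_shift_eq [IsProbabilityMeasure P] (hX : IsGaussianProcess X P)
    (hm : ∀ t, Measurable (X t)) (h0 : ∀ t, ∫ ω, X t ω ∂P = 0) {C : ℝ → ℝ}
    (hC : ∀ s t, covariance (X s) (X t) P = C (s - t)) (h : ℝ) :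
    P.map (fun (ω : Ω) (t : ℝ) => X (t + h) ω) = P.map (fun (ω : Ω) (t : ℝ) => X t ω) := by
  have hXh : IsGaussianProcess (fun t => X (t + h)) P := hX.comp_right fun t => t + h
  rw [map_eq_iff_forall_finset_map_restrict_eq
    (measurable_pi_iff.2 fun t => hm (t + h)).aemeasurable (measurable_pi_iff.2 hm).aemeasurable]
  intro I
  -- The characteristic function of each finite marginal involves only C at time differences, which
  -- a shift preserves.
  have hchar (Y : ℝ → Ω → ℝ) (hY : IsGaussianProcess Y P) (hY0 : ∀ t, ∫ ω, Y t ω ∂P = 0)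
      (hYC : ∀ s t, covariance (Y s) (Y t) P = C (s - t)) (L : StrongDual ℝ (I → ℝ)) :
      charFunDual (P.map fun ω => I.restrict (Y · ω)) L =
        Complex.exp (-((∑ i, ∑ j, L (Pi.single j 1) * (L (Pi.single i 1) * C (i - j)) : ℝ) : ℂ) / 2) := by
    have hL : (fun ω => L (I.restrict (Y · ω))) = fun ω => ∑ i : I, L (Pi.single i 1) * Y i ω := by
      ext ω
      exact L.apply_eq_sum_single _
    have hL2 (i : I) : MemLp (fun ω => L (Pi.single i 1) * Y i ω) 2 P :=
      (hY.hasGaussianLaw_eval i).memLp_two.const_mul _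
    rw [(hY.hasGaussianLaw I).charFunDual_map_eq_fun L]
    have hint : ∫ ω, L (I.restrict (Y · ω)) ∂P = 0 := by
      rw [hL, integral_finsetSum _ fun i _ => (hL2 i).integrable (by norm_num)]
      simp [integral_const_mul, hY0]
    rw [hint, hL, variance_fun_sum hL2]
    simp only [covariance_const_mul_left, covariance_const_mul_right, hYC]
    congr 1
    simp
    ring
  have := (hX.hasGaussianLaw I).isGaussian_map
  have := (hXh.hasGaussianLaw I).isGaussian_map
  refine Measure.ext_of_charFunDual ?_
  ext L
  rw [hchar _ hX h0 hC, hchar (fun t => X (t + h)) hXh (fun t => h0 _) fun s t => by rw [hC]; congr 1; ring]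

end stationary

/-! ### Gaussian sums in L². -/

section whiteNoise

/-- The law of a family of independent standard Gaussian variables indexed by `ι`. -/
noncomputable def stdGaussianPi (ι : Type*) : Measure (ι → ℝ) :=
  Measure.infinitePi fun _ : ι => gaussianReal 0 1

variable {ι : Type*}

instance : IsProbabilityMeasure (stdGaussianPi ι) := by unfold stdGaussianPi; infer_instance

theorem hasLaw_eval_stdGaussianPi (i : ι) :
    HasLaw (fun ω : ι → ℝ => ω i) (gaussianReal 0 1) (stdGaussianPi ι) where
  aemeasurable := (measurable_pi_apply i).aemeasurable
  map_eq := Measure.infinitePi_map_eval _ i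

theorem iIndepFun_eval_stdGaussianPi :
    iIndepFun (fun (i : ι) (ω : ι → ℝ) => ω i) (stdGaussianPi ι) :=
  iIndepFun_infinitePi (X := fun _ x => x) (by fun_prop)

theorem memLp_eval_stdGaussianPi (i : ι) : MemLp (fun ω : ι → ℝ => ω i) 2 (stdGaussianPi ι) :=
  (hasLaw_eval_stdGaussianPi i).hasGaussianLaw.memLp_two

/-- The coordinate variables as elements of `L²`. -/
noncomputable def coordLp (i : ι) : Lp ℝ 2 (stdGaussianPi ι) := (memLp_eval_stdGaussianPi i).toLp

theorem orthonormal_coordLp : Orthonormal ℝ (coordLp (ι := ι)) := by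
  classical
  rw [orthonormal_iff_ite]
  intro i j
  have : inner ℝ (coordLp i) (coordLp j) = ∫ ω : ι → ℝ, ω i * ω j ∂stdGaussianPi ι := by
    rw [L2.inner_def]
    refine integral_congr_ae ?_
    filter_upwards [(memLp_eval_stdGaussianPi i).coeFn_toLp, (memLp_eval_stdGaussianPi j).coeFn_toLp]
      with ω hi hj
    simp only [coordLp, hi, hj]
    simp [mul_comm]
  rw [this]
  have h0 (i : ι) : ∫ ω : ι → ℝ, ω i ∂stdGaussianPi ι = 0 := by
    rw [(hasLaw_eval_stdGaussianPi i).integral_eq, integral_id_gaussianReal]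
  split_ifs with h
  · subst h
    have hv := (hasLaw_eval_stdGaussianPi i).variance_eq
    rw [variance_of_integral_eq_zero (measurable_pi_apply i).aemeasurable (h0 i), variance_id_gaussianReal] at hv
    simpa [sq] using hv
  · rw [(iIndepFun_eval_stdGaussianPi.indepFun h).integral_fun_mul_eq_mul_integral
      (measurable_pi_apply i).aestronglyMeasurable (measurable_pi_apply j).aestronglyMeasurable, h0, zero_mul]

theorem integral_abs_Lp_two_le {Ω : Type*} {mΩ : MeasurableSpace Ω} {P : Measure Ω}
    [IsProbabilityMeasure P] (f : Lp ℝ 2 P) : ∫ ω, |f ω| ∂P ≤ ‖f‖ := by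
  have h := eLpNorm_le_eLpNorm_of_exponent_le (p := 1) (q := 2) (by norm_num) (Lp.aestronglyMeasurable f)
  have hi : Integrable f P := (Lp.memLp f).integrable (by norm_num)
  have h2 := ENNReal.toReal_mono (Lp.eLpNorm_ne_top f) h
  rw [Lp.norm_def]
  refine le_trans (le_of_eq ?_) h2
  rw [eLpNorm_one_eq_lintegral_enorm]
  simpa using integral_norm_eq_lintegral_enorm hi.1

/-- By |exp(ix) - 1| ≤ |x| and the L¹–L² inequality the map is |u|-Lipschitz. Hence being centred
Gaussian with variance ‖f‖² is a closed condition in L². -/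
theorem continuous_integral_exp_Lp_two {Ω : Type*} {mΩ : MeasurableSpace Ω} {P : Measure Ω}
    [IsProbabilityMeasure P] (u : ℝ) :
    Continuous fun f : Lp ℝ 2 P => ∫ ω, Complex.exp (u * f ω * Complex.I) ∂P := by
  have hint (f : Lp ℝ 2 P) : Integrable (fun ω => Complex.exp (u * f ω * Complex.I)) P := by
    refine Integrable.of_bound (C := 1) ?_ (Filter.Eventually.of_forall fun ω => ?_)
    · have := (Lp.aestronglyMeasurable f).aemeasurable
      exact AEMeasurable.aestronglyMeasurable (by fun_prop)
    · rw [← Complex.ofReal_mul, Complex.norm_exp_ofReal_mul_I]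
  refine (LipschitzWith.of_dist_le_mul (K := ‖u‖₊) fun f g => ?_).continuous
  rw [dist_eq_norm, dist_eq_norm, ← integral_sub (hint f) (hint g)]
  refine (norm_integral_le_integral_norm _).trans ?_
  refine le_trans ?_ (mul_le_mul_of_nonneg_left (integral_abs_Lp_two_le (f - g)) (norm_nonneg u))
  rw [← integral_const_mul]
  have hi : Integrable (f - g : Lp ℝ 2 P) P := (Lp.memLp _).integrable (by norm_num)
  refine integral_mono_ae ((hint f).sub (hint g)).norm (hi.abs.const_mul _) ?_
  filter_upwards [Lp.coeFn_sub f g] with ω hω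
  simp only [hω, Pi.sub_apply]
  have : Complex.exp (u * f ω * Complex.I) - Complex.exp (u * g ω * Complex.I) =
      Complex.exp (u * g ω * Complex.I) * (Complex.exp (Complex.I * (u * (f ω - g ω) : ℝ)) - 1) := by
    rw [mul_sub, ← Complex.exp_add, mul_one]
    congr 2
    push_cast
    ring
  rw [this, norm_mul, ← Complex.ofReal_mul, Complex.norm_exp_ofReal_mul_I, one_mul]
  refine (Real.norm_exp_I_mul_ofReal_sub_one_le).trans ?_
  rw [norm_mul, Real.norm_eq_abs (f ω - g ω), coe_nnnorm]

theorem coeFn_sum_smul_coordLp (s : Finset ι) (c : ι → ℝ) :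
    (∑ i ∈ s, c i • coordLp i : Lp ℝ 2 (stdGaussianPi ι)) =ᵐ[stdGaussianPi ι]
      fun ω => ∑ i ∈ s, c i * ω i := by
  have h1 : ∀ᵐ ω ∂stdGaussianPi ι, ∀ i ∈ s, (c i • coordLp i : Lp ℝ 2 (stdGaussianPi ι)) ω =
      c i * ω i := by
    rw [Filter.eventually_all_finset]
    intro i _
    filter_upwards [Lp.coeFn_smul (c i) (coordLp i), (memLp_eval_stdGaussianPi i).coeFn_toLp]
      with ω h1 h2
    rw [h1, Pi.smul_apply, smul_eq_mul, coordLp, h2]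
  filter_upwards [h1, Lp.coeFn_finsetSum (s := s) (f := fun i => c i • coordLp i)] with ω h1 h2
  rw [h2, Finset.sum_apply]
  exact Finset.sum_congr rfl h1

theorem integral_exp_finsupp_sum_coordLp (c : ι →₀ ℝ) (u : ℝ) :
    ∫ ω, Complex.exp (u * (c.sum fun i x => x • coordLp i : Lp ℝ 2 (stdGaussianPi ι)) ω * Complex.I)
      ∂stdGaussianPi ι =
      Complex.exp (-(‖(c.sum fun i x => x • coordLp i : Lp ℝ 2 (stdGaussianPi ι))‖ ^ 2 * u ^ 2 / 2 : ℝ)) := by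
  have hnorm : ‖(c.sum fun i x => x • coordLp i : Lp ℝ 2 (stdGaussianPi ι))‖ ^ 2 =
      ∑ i ∈ c.support, c i ^ 2 := by
    rw [← real_inner_self_eq_norm_sq, Finsupp.sum, orthonormal_coordLp.inner_sum]
    simp [sq]
  have hcoe : (c.sum fun i x => x • coordLp i : Lp ℝ 2 (stdGaussianPi ι)) =ᵐ[stdGaussianPi ι]
      fun ω => ∑ i ∈ c.support, c i * ω i := by
    rw [Finsupp.sum]
    exact coeFn_sum_smul_coordLp c.support c
  have hprod : ∀ᵐ ω ∂stdGaussianPi ι,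
      Complex.exp (u * (c.sum fun i x => x • coordLp i : Lp ℝ 2 (stdGaussianPi ι)) ω * Complex.I) =
        (fun y : c.support → ℝ => ∏ i : c.support, Complex.exp ((u * c i : ℝ) * y i * Complex.I))
          (c.support.restrict ω) := by
    filter_upwards [hcoe] with ω hω
    rw [hω, ← Complex.exp_sum, ← Finset.sum_coe_sort]
    congr 1
    push_cast
    rw [Finset.mul_sum, Finset.sum_mul]
    exact Finset.sum_congr rfl fun i _ => by simp; ring
  have hrestrict := integral_restrict_infinitePi (μ := fun _ : ι => gaussianReal 0 1) (s := c.support)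
    (f := fun y : c.support → ℝ => ∏ i : c.support, Complex.exp ((u * c i : ℝ) * y i * Complex.I))
    (Continuous.aestronglyMeasurable (by fun_prop))
  rw [integral_congr_ae hprod, hnorm, stdGaussianPi, hrestrict, integral_fintype_prod_eq_prod
    (f := fun (i : c.support) (x : ℝ) => Complex.exp ((u * c i : ℝ) * x * Complex.I))]
  simp only [← charFun_apply_real, charFun_gaussianReal]
  rw [← Complex.exp_sum, ← Finset.sum_coe_sort c.support fun i => c i ^ 2]
  congr 1
  push_cast
  rw [Finset.sum_mul, Finset.sum_div, ← Finset.sum_neg_distrib]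
  exact Finset.sum_congr rfl fun i _ => by simp; ring

/-- The elements of the closed linear span of the coordinates are centred Gaussian variables. -/
theorem map_eq_gaussianReal_of_mem_closure_span {w : Lp ℝ 2 (stdGaussianPi ι)}
    (hw : w ∈ (Submodule.span ℝ (range (coordLp (ι := ι)))).topologicalClosure) :
    (stdGaussianPi ι).map w = gaussianReal 0 (‖w‖₊ ^ 2) := by
  have hclosed : IsClosed {w : Lp ℝ 2 (stdGaussianPi ι) | ∀ u : ℝ,
      ∫ ω, Complex.exp (u * w ω * Complex.I) ∂stdGaussianPi ι =
        Complex.exp (-(‖w‖ ^ 2 * u ^ 2 / 2 : ℝ))} := by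
    rw [ofPred_forall]
    exact isClosed_iInter fun u =>
      isClosed_eq (continuous_integral_exp_Lp_two u) (by fun_prop)
  have hspan : (Submodule.span ℝ (range (coordLp (ι := ι))) : Set (Lp ℝ 2 (stdGaussianPi ι))) ⊆
      {w : Lp ℝ 2 (stdGaussianPi ι) | ∀ u : ℝ,
      ∫ ω, Complex.exp (u * w ω * Complex.I) ∂stdGaussianPi ι =
        Complex.exp (-(‖w‖ ^ 2 * u ^ 2 / 2 : ℝ))} := by
    intro w hw u
    obtain ⟨c, rfl⟩ := (Finsupp.mem_span_range_iff_exists_finsupp).1 hw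
    exact integral_exp_finsupp_sum_coordLp c u
  have hmem := closure_minimal hspan hclosed hw
  have hmeas := (Lp.aestronglyMeasurable w).aemeasurable
  have := Measure.isProbabilityMeasure_map hmeas
  refine Measure.ext_of_charFun ?_
  ext u
  rw [charFun_apply_real, charFun_gaussianReal, integral_map hmeas (by fun_prop), hmem u]
  congr 1
  push_cast
  simp

theorem summable_smul_coordLp {c : ι → ℝ} (hc : Summable fun i => c i ^ 2) :
    Summable fun i => c i • coordLp i := by
  have := (orthonormal_coordLp (ι := ι)).orthogonalFamily.summable_iff_norm_sq_summable c
  simpa [hc] using this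

/-- The Gaussian variable `∑ c i ω i`, as a sum in `L²`. -/
noncomputable def gaussianSum (c : ι → ℝ) : Lp ℝ 2 (stdGaussianPi ι) := ∑' i, c i • coordLp i

theorem gaussianSum_mem_closure_span (c : ι → ℝ) :
    gaussianSum c ∈ (Submodule.span ℝ (range (coordLp (ι := ι)))).topologicalClosure := by
  unfold gaussianSum
  by_cases hc : Summable fun i => c i • coordLp i
  · refine (Submodule.isClosed_topologicalClosure _).mem_of_tendsto hc.hasSum
      (Filter.Eventually.of_forall fun s => ?_)
    exact Submodule.sum_mem _ fun i _ => Submodule.smul_mem _ _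
      (Submodule.le_topologicalClosure _ (Submodule.subset_span (mem_range_self i)))
  -- A divergent sum has the default value 0, which also lies in the span.
  · rw [tsum_eq_zero_of_not_summable hc]
    exact Submodule.zero_mem _

theorem inner_gaussianSum {c d : ι → ℝ} (hc : Summable fun i => c i ^ 2) (hd : Summable fun i => d i ^ 2) :
    inner ℝ (gaussianSum c) (gaussianSum d) = ∑' i, c i * d i := by
  classical
  have hcoord (i : ι) : inner ℝ (coordLp i) (gaussianSum d) = d i := by
    have h := (summable_smul_coordLp hd).hasSum.mapL (innerSL ℝ (coordLp i))
    simp only [innerSL_apply_apply, inner_smul_right, orthonormal_iff_ite.1 orthonormal_coordLp] at h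
    refine h.unique ?_
    have heq : (fun j => d j * if i = j then (1 : ℝ) else 0) = fun j => if j = i then d i else 0 := by
      ext j
      by_cases hij : i = j
      · subst hij; simp
      · simp [hij, Ne.symm hij]
    rw [heq]
    exact hasSum_ite_eq i (d i)
  have h := (summable_smul_coordLp hc).hasSum.mapL (innerSL ℝ (gaussianSum d))
  simp only [innerSL_apply_apply, inner_smul_right, real_inner_comm (coordLp _), hcoord] at h
  rw [real_inner_comm]
  exact h.tsum_eq.symm

/-- If the random series converges pointwise almost surely, then it agrees with its sum in `L²`. -/
theorem ae_eq_gaussianSum_of_hasSum [Countable ι] {c : ι → ℝ} (hc : Summable fun i => c i ^ 2)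
    {Y : (ι → ℝ) → ℝ} (hY : ∀ᵐ ω ∂stdGaussianPi ι, HasSum (fun i => c i * ω i) (Y ω)) :
    Y =ᵐ[stdGaussianPi ι] gaussianSum c := by
  have h : Filter.Tendsto (fun s : Finset ι => ∑ i ∈ s, c i • coordLp i) Filter.atTop
      (nhds (gaussianSum c)) := (summable_smul_coordLp hc).hasSum
  -- Some sequence of partial sums converges almost everywhere to the L² sum; pointwise summability
  -- gives it the limit Y.
  obtain ⟨S, hS, hlim⟩ := (tendstoInMeasure_of_tendsto_Lp h).exists_seq_tendsto_ae'
  have hcoe (s : Finset ι) : ∀ᵐ ω ∂stdGaussianPi ι,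
      (∑ i ∈ s, c i • coordLp i : Lp ℝ 2 (stdGaussianPi ι)) ω = ∑ i ∈ s, c i * ω i := by
    exact coeFn_sum_smul_coordLp s c
  filter_upwards [hY, hlim, ae_all_iff.2 fun n => hcoe (S n)] with ω h1 h2 h3
  simp only [h3] at h2
  exact tendsto_nhds_unique (h1.comp hS) h2

/-- Every linear functional of a finite marginal stays in the closed span of the coordinates, where
all elements are Gaussian. -/
theorem isGaussianProcess_gaussianSum {T : Type*} (c : T → ι → ℝ) :
    IsGaussianProcess (fun t ω => gaussianSum (c t) ω) (stdGaussianPi ι) where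
  hasGaussianLaw I := by
    classical
    have hm (t : T) : AEMeasurable (gaussianSum (c t)) (stdGaussianPi ι) :=
      (Lp.aestronglyMeasurable _).aemeasurable
    have hmI : AEMeasurable (fun ω => I.restrict fun t => gaussianSum (c t) ω) (stdGaussianPi ι) :=
      aemeasurable_pi_lambda _ fun i => hm i
    refine ⟨isGaussian_of_map_eq_gaussianReal fun L => ?_⟩
    have hsum : ∀ᵐ ω ∂stdGaussianPi ι, L (I.restrict fun t => gaussianSum (c t) ω) =
        (∑ i : I, L (Pi.single i 1) • gaussianSum (c i) : Lp ℝ 2 (stdGaussianPi ι)) ω := by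
      have h1 : ∀ᵐ ω ∂stdGaussianPi ι, ∀ i : I,
          (L (Pi.single i 1) • gaussianSum (c i) : Lp ℝ 2 (stdGaussianPi ι)) ω =
            L (Pi.single i 1) * gaussianSum (c i) ω :=
        ae_all_iff.2 fun i => Lp.coeFn_smul _ _
      filter_upwards [h1, Lp.coeFn_finsetSum (s := Finset.univ)
        (f := fun i : I => L (Pi.single i 1) • gaussianSum (c i))] with ω h1 h2
      rw [h2, Finset.sum_apply, L.apply_eq_sum_single]
      exact Finset.sum_congr rfl fun i _ => (h1 i).symm
    refine ⟨0, ‖(∑ i : I, L (Pi.single i 1) • gaussianSum (c i) : Lp ℝ 2 (stdGaussianPi ι))‖₊ ^ 2, ?_⟩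
    rw [← map_eq_gaussianReal_of_mem_closure_span (Submodule.sum_mem _ fun i _ =>
      Submodule.smul_mem _ _ (gaussianSum_mem_closure_span _)),
      AEMeasurable.map_map_of_aemeasurable (by fun_prop) hmI]
    exact Measure.map_congr hsum

/-- A measurable modification of a family of Gaussian sums is a stationary Gaussian process as soon as
its covariance depends only on the time difference. -/
theorem isStationaryGaussian_of_ae_eq_gaussianSum {X : ℝ → (ι → ℝ) → ℝ} (hm : ∀ t, Measurable (X t))
    {c : ℝ → ι → ℝ} (hc : ∀ t, Summable fun i => c t i ^ 2)
    (hX : ∀ t, X t =ᵐ[stdGaussianPi ι] gaussianSum (c t)) {C : ℝ → ℝ}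
    (hC : ∀ s t, ∑' i, c s i * c t i = C (s - t)) :
    IsStationaryGaussian (stdGaussianPi ι) X C := by
  have hG : IsGaussianProcess X (stdGaussianPi ι) :=
    (isGaussianProcess_gaussianSum c).congr fun t => (hX t).symm
  have h0 (t : ℝ) : ∫ ω, X t ω ∂stdGaussianPi ι = 0 := by
    have h : HasLaw (X t) (gaussianReal 0 (‖gaussianSum (c t)‖₊ ^ 2)) (stdGaussianPi ι) :=
      ⟨(hm t).aemeasurable, by
        rw [Measure.map_congr (hX t),
          map_eq_gaussianReal_of_mem_closure_span (gaussianSum_mem_closure_span _)]⟩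
    rw [h.integral_eq, integral_id_gaussianReal]
  have hcov (s t : ℝ) : covariance (X s) (X t) (stdGaussianPi ι) = C (s - t) := by
    rw [covariance_eq_sub (hG.hasGaussianLaw_eval s).memLp_two (hG.hasGaussianLaw_eval t).memLp_two,
      h0, zero_mul, sub_zero, ← hC, ← inner_gaussianSum (hc s) (hc t), L2.inner_def]
    refine integral_congr_ae ?_
    filter_upwards [hX s, hX t] with ω h1 h2
    simp [h1, h2, mul_comm]
  exact ⟨hm, hG, h0, hG.map_shift_eq hm h0 hcov, hcov⟩

end whiteNoise

/-! ### A version with good paths everywhere. -/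

section gatedCosSeries
variable {ι : Type*}

/-- The expectation of ∑ |bᵢωᵢ| is ∑ |bᵢ| times the first absolute moment of a standard Gaussian,
hence finite. -/
theorem ae_mem_absSummableSet [Countable ι] {b : ι → ℝ} (hb : Summable fun i => |b i|) :
    ∀ᵐ ω ∂stdGaussianPi ι, ω ∈ absSummableSet b := by
  have hm : ∫⁻ x, ENNReal.ofReal |x| ∂gaussianReal 0 1 ≠ ⊤ := by
    have hi : Integrable (fun x : ℝ => |x|) (gaussianReal 0 1) :=
      (IsGaussian.integrable_id (μ := gaussianReal 0 1)).abs
    exact (hi.lintegral_lt_top).ne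
  have hint : ∫⁻ ω, ∑' i, ENNReal.ofReal |b i * ω i| ∂stdGaussianPi ι ≠ ⊤ := by
    rw [lintegral_tsum fun i => (by fun_prop : Measurable fun ω : ι → ℝ =>
      ENNReal.ofReal |b i * ω i|).aemeasurable]
    have heval (i : ι) : ∫⁻ ω, ENNReal.ofReal |b i * ω i| ∂stdGaussianPi ι =
        ENNReal.ofReal |b i| * ∫⁻ x, ENNReal.ofReal |x| ∂gaussianReal 0 1 := by
      rw [← (hasLaw_eval_stdGaussianPi i).map_eq, lintegral_map (by fun_prop) (measurable_pi_apply i),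
        ← lintegral_const_mul _ (by fun_prop)]
      simp_rw [abs_mul, ENNReal.ofReal_mul (abs_nonneg _)]
    simp_rw [heval, ENNReal.tsum_mul_right]
    exact ENNReal.mul_ne_top hb.tsum_ofReal_ne_top hm
  filter_upwards [ae_lt_top (measurable_tsum_ofReal_abs_mul b) hint] with ω hω
  exact mem_absSummableSet_iff.2 hω.ne

open Classical in
/-- The random almost periodic series on the event `G`, and the constant `1` off `G`. -/
noncomputable def gatedCosSeries (G : Set (ι → ℝ)) (b θ δ : ι → ℝ) (t : ℝ) (ω : ι → ℝ) : ℝ :=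
  if ω ∈ G then cosSeries (fun i => b i * ω i) θ δ t else 1

variable {G : Set (ι → ℝ)} {b θ δ : ι → ℝ}

theorem gatedCosSeries_of_mem {ω : ι → ℝ} (hω : ω ∈ G) (t : ℝ) :
    gatedCosSeries G b θ δ t ω = cosSeries (fun i => b i * ω i) θ δ t := if_pos hω

theorem measurable_gatedCosSeries [Countable ι] (hG : MeasurableSet G) (t : ℝ) : Measurable (gatedCosSeries G b θ δ t) := by
  classical
  refine Measurable.ite hG ?_ measurable_const
  exact Measurable.tsum fun i => by fun_prop

theorem gatedCosSeries_of_notMem {ω : ι → ℝ} (hω : ω ∉ G) (t : ℝ) :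
    gatedCosSeries G b θ δ t ω = 1 := if_neg hω

theorem continuous_gatedCosSeries (hG : G ⊆ absSummableSet b) (ω : ι → ℝ) :
    Continuous fun t => gatedCosSeries G b θ δ t ω := by
  by_cases hω : ω ∈ G
  · simp only [gatedCosSeries_of_mem hω]
    exact continuous_cosSeries (hG hω) θ δ
  · simp only [gatedCosSeries_of_notMem hω]
    exact continuous_const

theorem zerosAreCrossings_gatedCosSeries
    (hG : ∀ ω ∈ G, ZerosAreCrossings (cosSeries (fun i => b i * ω i) θ δ)) (ω : ι → ℝ) :
    ZerosAreCrossings fun t => gatedCosSeries G b θ δ t ω := by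
  by_cases hω : ω ∈ G
  · simp only [gatedCosSeries_of_mem hω]
    exact hG ω hω
  · simp only [gatedCosSeries_of_notMem hω]
    -- The constant 1 has no zeros, so the condition is vacuous off `G`.
    exact fun _ _ _ h => (one_ne_zero h).elim

open Filter Topology in
theorem eventually_abs_gatedCosSeries_add_sub_lt (hG : G ⊆ absSummableSet b) {τ : ℕ → ℝ}
    (hτ : ∀ i, Tendsto (fun n => phaseDist (θ i * τ n)) atTop (𝓝 0)) (ω : ι → ℝ) {ε : ℝ} (hε : 0 < ε) :
    ∀ᶠ n in atTop, ∀ t, |gatedCosSeries G b θ δ (t + τ n) ω - gatedCosSeries G b θ δ t ω| < ε := by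
  by_cases hω : ω ∈ G
  · simp only [gatedCosSeries_of_mem hω]
    exact eventually_abs_cosSeries_add_sub_lt hτ (hG hω) δ hε
  · simp only [gatedCosSeries_of_notMem hω, sub_self, abs_zero]
    exact Eventually.of_forall fun _ _ => hε

theorem isCompletelyPredictable_zeroSet_gatedCosSeries [Countable ι] (hG : G ⊆ absSummableSet b)
    (hG' : ∀ ω ∈ G, ZerosAreCrossings (cosSeries (fun i => b i * ω i) θ δ)) :
    IsCompletelyPredictable (zeroSet (gatedCosSeries G b θ δ)) := by
  obtain ⟨τ, hτ, hlim⟩ := exists_tendsto_atBot_phaseDist θ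
  exact isCompletelyPredictable_zeroSet (continuous_gatedCosSeries hG) (zerosAreCrossings_gatedCosSeries hG') hτ
    fun ω ε hε => eventually_abs_gatedCosSeries_add_sub_lt hG hlim ω hε

end gatedCosSeries

/-! ### Cosine–sine pairs and the covariance. -/

section cosSin

/-- The phases turning the cosine into cosine (`true`) and sine (`false`). -/
noncomputable def quadraturePhase (i : ℕ × Bool) : ℝ := if i.2 then 0 else -(Real.pi / 2)

theorem cos_add_quadraturePhase_true (x : ℝ) (i : ℕ) :
    Real.cos (x + quadraturePhase (i, true)) = Real.cos x := by
  simp [quadraturePhase]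

theorem cos_add_quadraturePhase_false (x : ℝ) (i : ℕ) :
    Real.cos (x + quadraturePhase (i, false)) = Real.sin x := by
  simp [quadraturePhase, ← sub_eq_add_neg, Real.cos_sub_pi_div_two]

theorem summable_prod_bool {f : ℕ → ℝ} (hf : Summable f) (h0 : ∀ i, 0 ≤ f i) :
    Summable fun k : ℕ × Bool => f k.1 := by
  simpa using hf.mul_of_nonneg (g := fun _ : Bool => (1 : ℝ)) (Summable.of_finite) h0 fun _ => zero_le_one

theorem summable_sq_cosSin {A : ℕ → ℝ} (hA : Summable fun i => A i ^ 2) (φ : ℕ → ℝ) (t : ℝ) :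
    Summable fun k : ℕ × Bool => (A k.1 * Real.cos (φ k.1 * t + quadraturePhase k)) ^ 2 := by
  refine Summable.of_nonneg_of_le (fun k => sq_nonneg _) (fun k => ?_)
    (summable_prod_bool hA fun i => sq_nonneg _)
  rw [mul_pow]
  exact mul_le_of_le_one_right (sq_nonneg _) (Real.cos_sq_le_one _)

theorem tsum_cosSin_mul {A : ℕ → ℝ} (hA : Summable fun i => A i ^ 2) (φ : ℕ → ℝ) (s t : ℝ) :
    ∑' k : ℕ × Bool, A k.1 * Real.cos (φ k.1 * s + quadraturePhase k) *
      (A k.1 * Real.cos (φ k.1 * t + quadraturePhase k)) = ∑' i, A i ^ 2 * Real.cos (φ i * (s - t)) := by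
  have hs : Summable fun k : ℕ × Bool => A k.1 * Real.cos (φ k.1 * s + quadraturePhase k) *
      (A k.1 * Real.cos (φ k.1 * t + quadraturePhase k)) := by
    refine Summable.of_norm_bounded (summable_prod_bool hA fun i => sq_nonneg _) fun k => ?_
    rw [norm_mul, ← sq_abs, sq]
    exact mul_le_mul (norm_mul_cos_le _ _) (norm_mul_cos_le _ _) (norm_nonneg _) (abs_nonneg _)
  rw [hs.tsum_prod]
  refine tsum_congr fun i => ?_
  rw [tsum_fintype, Fintype.sum_bool]
  simp only [cos_add_quadraturePhase_true, cos_add_quadraturePhase_false]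
  rw [mul_sub, Real.cos_sub]
  ring

/-- A square-summable spectrum is realised by a stationary Gaussian process. -/
theorem exists_isStationaryGaussian {A : ℕ → ℝ} (hA : Summable fun i => A i ^ 2) (φ : ℕ → ℝ) :
    ∃ X : ℝ → (ℕ × Bool → ℝ) → ℝ,
      IsStationaryGaussian (stdGaussianPi (ℕ × Bool)) X fun x => ∑' i, A i ^ 2 * Real.cos (φ i * x) :=
  ⟨fun t => gaussianSum fun k => A k.1 * Real.cos (φ k.1 * t + quadraturePhase k),
    isStationaryGaussian_of_ae_eq_gaussianSum (fun _ => (Lp.stronglyMeasurable _).measurable)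
      (summable_sq_cosSin hA φ) (fun _ => Filter.EventuallyEq.rfl) (tsum_cosSin_mul hA φ)⟩

theorem isStationaryGaussian_gatedCosSeries {A : ℕ → ℝ} (hA : Summable fun i => A i ^ 2) (φ : ℕ → ℝ)
    {G : Set (ℕ × Bool → ℝ)} (hGm : MeasurableSet G) (hG : ∀ᵐ ω ∂stdGaussianPi (ℕ × Bool), ω ∈ G)
    (hGs : G ⊆ absSummableSet fun k => A k.1) :
    IsStationaryGaussian (stdGaussianPi (ℕ × Bool))
      (gatedCosSeries G (fun k => A k.1) (fun k => φ k.1) quadraturePhase)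
      fun x => ∑' i, A i ^ 2 * Real.cos (φ i * x) := by
  refine isStationaryGaussian_of_ae_eq_gaussianSum (measurable_gatedCosSeries hGm)
    (summable_sq_cosSin hA φ) (fun t => ae_eq_gaussianSum_of_hasSum (summable_sq_cosSin hA φ t) ?_)
    (tsum_cosSin_mul hA φ)
  filter_upwards [hG] with ω hω
  rw [gatedCosSeries_of_mem hω, cosSeries]
  simpa only [mul_right_comm] using
    (summable_cosSeries (hGs hω) (fun k => φ k.1) quadraturePhase t).hasSum

theorem isStationaryGaussian_zero : IsStationaryGaussian (stdGaussianPi (ℕ × Bool)) (fun _ _ => 0) 0 := by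
  refine isStationaryGaussian_of_ae_eq_gaussianSum (fun _ => measurable_const) (c := fun _ _ => 0)
    (fun t => by simp) (fun t => ae_eq_gaussianSum_of_hasSum (by simp) ?_) (by simp)
  simp

theorem exists_mul_cos_add_quadraturePhase_ne_zero {A : ℕ → ℝ} (hA : ∃ i, A i ≠ 0) (φ : ℕ → ℝ) (t : ℝ) :
    ∃ k : ℕ × Bool, A k.1 * Real.cos (φ k.1 * t + quadraturePhase k) ≠ 0 := by
  obtain ⟨i, hi⟩ := hA
  by_contra! h
  have hc : Real.cos (φ i * t) = 0 := by
    simpa [hi, cos_add_quadraturePhase_true] using h (i, true)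
  have hs : Real.sin (φ i * t) = 0 := by
    simpa [hi, cos_add_quadraturePhase_false] using h (i, false)
  simpa [hc, hs] using Real.sin_sq_add_cos_sq (φ i * t)

end cosSin

/-! ### The main theorem. -/

theorem mainTheorem6 (a φ : ℕ → ℝ) (ha_nonneg : ∀ i : ℕ, 0 ≤ a i) (ha : Summable a) :
    (IsBohrAlmostPeriodic (fun x : ℝ => ∑' i : ℕ, a i ^ 2 * Real.cos (φ i * x)) ∧
      ∃ (Ω : Type) (mΩ : MeasurableSpace Ω) (P : Measure Ω) (X : ℝ → Ω → ℝ),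
        IsProbabilityMeasure P ∧
        IsStationaryGaussian P X (fun x : ℝ => ∑' i : ℕ, a i ^ 2 * Real.cos (φ i * x)) ∧
        (∀ᵐ ω ∂P, ∃ M : ℝ, ∀ t : ℝ, |X t ω| ≤ M) ∧
        (∀ᵐ ω ∂P, IsBohrAlmostPeriodic (fun t : ℝ => X t ω)) ∧
        sigmaOf (zeroSet X) ≤ mΩ ∧
        IsCompletelyPredictable (zeroSet X)) ∧
    (IsBohrAlmostPeriodic (fun x : ℝ => ∑' i : ℕ, a i * Real.cos (φ i * x)) ∧
      ∃ (Ω : Type) (_ : MeasurableSpace Ω) (P : Measure Ω) (X : ℝ → Ω → ℝ),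
        IsProbabilityMeasure P ∧
        IsStationaryGaussian P X (fun x : ℝ => ∑' i : ℕ, a i * Real.cos (φ i * x))) := by
  have habs : Summable fun i => |a i| := ha.abs
  have hsq : Summable fun i => a i ^ 2 := by
    have := (ha.mul_of_nonneg ha ha_nonneg ha_nonneg).comp_injective
      (i := fun i : ℕ => (i, i)) fun _ _ h => (Prod.mk.inj h).1
    simpa [Function.comp_def, sq] using this
  have hbohr {A : ℕ → ℝ} (hA : Summable fun i => |A i|) :
      IsBohrAlmostPeriodic fun x : ℝ => ∑' i : ℕ, A i * Real.cos (φ i * x) := by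
    have := isBohrAlmostPeriodic_cosSeries hA φ 0
    unfold cosSeries at this
    simpa using this
  refine ⟨⟨hbohr hsq.abs, ?_⟩, hbohr habs, ?_⟩
  · by_cases hne : ∃ i, a i ≠ 0
    · have hb : Summable fun k : ℕ × Bool => |a k.1| := summable_prod_bool habs fun _ => abs_nonneg _
      have hcross : ∀ᵐ ω ∂stdGaussianPi (ℕ × Bool), ω ∈ absSummableSet (fun k : ℕ × Bool => a k.1) →
          ZerosAreCrossings (cosSeries (fun k : ℕ × Bool => a k.1 * ω k) (fun k => φ k.1) quadraturePhase) := by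
        have : NullSingletonClass (gaussianReal 0 1) := nullSingletonClass_gaussianReal one_ne_zero
        exact ae_zerosAreCrossings_cosSeries _ _ _ (exists_mul_cos_add_quadraturePhase_ne_zero hne φ)
      obtain ⟨G, hGae, hGm, hG⟩ :=
        ((ae_mem_absSummableSet hb).and hcross).exists_measurable_mem
      have hGs : G ⊆ absSummableSet fun k : ℕ × Bool => a k.1 := fun ω hω => (hG ω hω).1
      have hGc : ∀ ω ∈ G, ZerosAreCrossings
          (cosSeries (fun k : ℕ × Bool => a k.1 * ω k) (fun k => φ k.1) quadraturePhase) :=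
        fun ω hω => (hG ω hω).2 (hG ω hω).1
      refine ⟨ℕ × Bool → ℝ, inferInstance, stdGaussianPi _,
        gatedCosSeries G (fun k => a k.1) (fun k => φ k.1) quadraturePhase, inferInstance,
        isStationaryGaussian_gatedCosSeries hsq φ hGm hGae hGs, ?_, ?_,
        sigmaOf_zeroSet_le (measurable_gatedCosSeries hGm) (continuous_gatedCosSeries hGs)
          (zerosAreCrossings_gatedCosSeries hGc),
        isCompletelyPredictable_zeroSet_gatedCosSeries hGs hGc⟩
      · filter_upwards [hGae] with ω hω
        simp only [gatedCosSeries_of_mem hω]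
        exact ⟨_, abs_cosSeries_le (hGs hω) _ _⟩
      · filter_upwards [hGae] with ω hω
        simp only [gatedCosSeries_of_mem hω]
        exact isBohrAlmostPeriodic_cosSeries (hGs hω) _ _
    -- If all amplitudes vanish, zeros are not crossings, but the zero set is the whole line and its
    -- σ-algebra is trivial.
    · push Not at hne
      have hzero : zeroSet (fun (_ : ℝ) (_ : ℕ × Bool → ℝ) => (0 : ℝ)) = fun _ => univ := by
        ext; simp [zeroSet]
      refine ⟨ℕ × Bool → ℝ, inferInstance, stdGaussianPi _, fun _ _ => 0, inferInstance, ?_,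
        Filter.Eventually.of_forall fun _ => ⟨0, by simp⟩,
        Filter.Eventually.of_forall fun _ => ⟨continuous_const, fun ε hε => ⟨1, one_pos, fun s =>
          ⟨s, by simp, by simpa using hε⟩⟩⟩, ?_, ?_⟩
      · convert isStationaryGaussian_zero
        simp [hne]
      · rw [hzero, sigmaOf_const]
        exact bot_le
      · rw [hzero]
        exact isCompletelyPredictable_const _
  · have hsqrt (i : ℕ) : √(a i) ^ 2 = a i := Real.sq_sqrt (ha_nonneg i)
    obtain ⟨X, hX⟩ := exists_isStationaryGaussian (A := fun i => √(a i)) (by simpa only [hsqrt]) φ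
    exact ⟨ℕ × Bool → ℝ, inferInstance, stdGaussianPi _, X, inferInstance, by simpa only [hsqrt] using hX⟩
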